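/- Let $k$ be a field and let $E=(x^t,x^{t-1}y^{m_1},\dots,xy^{m_{t-1}},y^{m_t})\subset k[x,y]$, with $0=m_0\le m_1\le\dots\le m_t$, be a monomial ideal of finite positive colength $d$. Put $d_j=m_j-m_{j-1}$ for $1\le j\le t$. For $1\le i\le t+1$ and $1\le j\le t$ let $a_{i,j}=\sum_k a_{i,j,k}y^k$, where the $a_{i,j,k}$ are independent variables, with $0\le k<d_j$ if $i>j$ and $0\le k<d_i$ if $i\le j$. Let $k[\mathbf a]$ be the polynomial ring in all the $a_{i,j,k}$ and let $B=\operatorname{Spec}k[\mathbf a]$. Let $\mathcal M$ be the $(t+1)\times t$ matrix over $k[\mathbf a][x,y]$ whose $(i,j)$ entry is $a_{i,j}$, plus $y^{d_j}$ if $i=j$, minus $x$ if $i=j+1$. Let $I_t(\mathcal M)$ be the ideal generated by its maximal minors, and let $\pi\colon V(I_t(\mathcal M))\to B$ be the restriction of the projection $\mathbb A^2\times B\to B$. Let $\mathrm{res}_E\in k[\mathbf a][y]$ be the resultant with respect to $x$ of the two minors of $\mathcal M$ obtained by deleting the first row and the last row, respectively. Let $\mathbb G_m^2$ act on $B$ through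 the $\mathbb Z^2$-grading $\deg a_{i,j,k}=(i-j,\;m_j-m_{i-1}-k)$ of $k[\mathbf a]$ (that is, $\deg x=(1,0)$, $\deg y=(0,1)$, $\deg(a_{i,j,k}y^k)=(i-j,\;m_j-m_{i-1})$). Let $B'\subset B$ be the complement of the common vanishing locus of all the coefficients in $k[\mathbf a]$ of $\mathrm{res}_E$ as a polynomial in $y$. Then $B'$ is a $\mathbb G_m^2$-stable open subscheme of $B$, and $\pi$ is flat over $B'$. -/

import Mathlib

set_option maxSynthPendingDepth 3

open CategoryTheory AlgebraicGeometry Limits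
open scoped TensorProduct Polynomial

universe u

noncomputable section

namespace HilbertBurch

/-- `E = (x^t, x^(t-1) y^(m 1), …, x y^(m (t-1)), y^(m t))` with `0 = m 0 ≤ m 1 ≤ … ≤ m t`.
The ring `𝕜[x,y]` is written `𝕜[X][X]`: the outer variable is `x` and the inner variable is `y`. -/
structure IsStaircase {𝕜 : Type u} [Field 𝕜] (E : Ideal 𝕜[X][X]) (t : ℕ) (m : Fin (t + 1) → ℕ) :
    Prop where
  zero : m 0 = 0
  mono : Monotone m
  eq_span : E = Ideal.span (Set.range fun i : Fin (t + 1) ↦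
    (Polynomial.X : 𝕜[X][X]) ^ (t - (i : ℕ)) * Polynomial.C ((Polynomial.X : 𝕜[X]) ^ m i))

section

variable {t : ℕ} (m : Fin (t + 1) → ℕ)

/-- The differences `d_j = m_j - m_(j-1)`; rows, columns and the differences are numbered from `0`,
so the entry with index `j` here is `d_(j+1)` in the numbering from `1`. -/
def diff (j : Fin t) : ℕ := m j.succ - m j.castSucc

/-- The strict bound on the `y`-degree of the entry `a_(i,j)`: it is `d_j` below the diagonal
(`i > j`) and `d_i` on and above the diagonal (`i ≤ j`). -/
def degBound (i : Fin (t + 1)) (j : Fin t) : ℕ :=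
  if h : (j : ℕ) < i then diff m j else diff m ⟨i, (not_lt.mp h).trans_lt j.isLt⟩

/-- The index set of the parameters `a_(i,j,k)`, with `k < degBound m i j`. -/
abbrev ParamIdx : Type := Σ p : Fin (t + 1) × Fin t, Fin (degBound m p.1 p.2)

variable (𝕜 : Type u) [Field 𝕜]

/-- The polynomial ring `𝕜[𝐚]` in the parameters. -/
abbrev ParamRing : Type u := MvPolynomial (ParamIdx m) 𝕜

/-- The entry `a_(i,j) = ∑ₖ a_(i,j,k) y^k` in `𝕜[𝐚][y]`. -/
def paramEntry (i : Fin (t + 1)) (j : Fin t) : (ParamRing m 𝕜)[X] :=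
  ∑ k : Fin (degBound m i j), Polynomial.C (MvPolynomial.X ⟨(i, j), k⟩) * Polynomial.X ^ (k : ℕ)

/-- The spread out matrix, with `t + 1` rows and `t` columns and entries in `𝕜[𝐚][y][x]`: the entry
at `(i,j)` is `a_(i,j)`, plus `y^(d_i)` on the diagonal, minus `x` just below the diagonal. -/
def spreadMatrix : Matrix (Fin (t + 1)) (Fin t) (ParamRing m 𝕜)[X][X] :=
  Matrix.of fun i j ↦
    (if i = j.castSucc then Polynomial.C (Polynomial.X ^ diff m j) else 0)
      - (if i = j.succ then Polynomial.X else 0) + Polynomial.C (paramEntry m 𝕜 i j)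

/-- The `i`-th maximal minor: the determinant of the matrix with the `i`-th row removed. -/
def maxMinor (i : Fin (t + 1)) : (ParamRing m 𝕜)[X][X] :=
  ((spreadMatrix m 𝕜).submatrix i.succAbove id).det

/-- The ideal `I_t(ℳ)` of `𝕜[𝐚][x,y]` generated by the maximal minors. -/
def minorIdeal : Ideal (ParamRing m 𝕜)[X][X] := Ideal.span (Set.range (maxMinor m 𝕜))

/-- The resultant `res_E ∈ 𝕜[𝐚][y]`, with respect to `x`, of the first and the last minor. -/
def resE : (ParamRing m 𝕜)[X] :=
  Polynomial.resultant (maxMinor m 𝕜 0) (maxMinor m 𝕜 (Fin.last t))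

/-- The base `B = Spec 𝕜[𝐚]`. -/
abbrev base : Scheme.{u} := Spec (CommRingCat.of (ParamRing m 𝕜))

/-- The structure morphism `B ⟶ Spec 𝕜`. -/
abbrev baseStr : base m 𝕜 ⟶ Spec (CommRingCat.of 𝕜) :=
  Spec.map (CommRingCat.ofHom (algebraMap 𝕜 (ParamRing m 𝕜)))

/-- `𝔸² × B = Spec 𝕜[𝐚][x,y]`. -/
abbrev planeOverBase : Scheme.{u} := Spec (CommRingCat.of (ParamRing m 𝕜)[X][X])

/-- The projection `𝔸² × B ⟶ B`. -/
def planeProj : planeOverBase m 𝕜 ⟶ base m 𝕜 :=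
  Spec.map (CommRingCat.ofHom
    ((Polynomial.C : (ParamRing m 𝕜)[X] →+* (ParamRing m 𝕜)[X][X]).comp Polynomial.C))

/-- The closed subscheme `V(I_t(ℳ))` of `𝔸² × B`. -/
abbrev vanishing : Scheme.{u} :=
  Spec (CommRingCat.of ((ParamRing m 𝕜)[X][X] ⧸ minorIdeal m 𝕜))

/-- The closed immersion `V(I_t(ℳ)) ⟶ 𝔸² × B`. -/
def vanishingIncl : vanishing m 𝕜 ⟶ planeOverBase m 𝕜 :=
  Spec.map (CommRingCat.ofHom (Ideal.Quotient.mk (minorIdeal m 𝕜)))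

/-- The family `π : V(I_t(ℳ)) ⟶ B`. -/
def familyMap : vanishing m 𝕜 ⟶ base m 𝕜 := vanishingIncl m 𝕜 ≫ planeProj m 𝕜

/-- The locus `B'`: the complement of the common vanishing locus in `B` of the coefficients of
`res_E` as a polynomial in `y`. -/
def resLocus : Set (base m 𝕜) :=
  (PrimeSpectrum.zeroLocus (Set.range (resE m 𝕜).coeff))ᶜ

/-- The bidegree of the parameter `a_(i,j,k)`: since `y` has bidegree `(0,1)` and `a_(i,j)` has
bidegree `(i - j, m_j - m_(i-1))` in the numbering from `1`, it is
`(i - j, m_j - m_(i-1) - k)`. -/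
def bidegree (p : ParamIdx m) : ℤ × ℤ :=
  ((p.1.1 : ℤ) - (p.1.2 : ℤ), (m p.1.2.succ : ℤ) - (m p.1.1 : ℤ) - (p.2 : ℤ))

/-- The coordinate ring `𝕜[ℤ²] = 𝕜[u, u⁻¹, v, v⁻¹]` of the torus `𝔾ₘ²`. -/
abbrev TorusRing : Type u := AddMonoidAlgebra 𝕜 (ℤ × ℤ)

/-- The torus `𝔾ₘ²` over `𝕜`. -/
abbrev torus : Scheme.{u} := Spec (CommRingCat.of (TorusRing 𝕜))

/-- The structure morphism `𝔾ₘ² ⟶ Spec 𝕜`. -/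
abbrev torusStr : torus 𝕜 ⟶ Spec (CommRingCat.of 𝕜) :=
  Spec.map (CommRingCat.ofHom (algebraMap 𝕜 (TorusRing 𝕜)))

/-- The coaction of the grading: a parameter of bidegree `(p, q)` is sent to `u^p v^q` times
itself. -/
def coaction : ParamRing m 𝕜 →ₐ[𝕜] TorusRing 𝕜 ⊗[𝕜] ParamRing m 𝕜 :=
  MvPolynomial.aeval fun p ↦ AddMonoidAlgebra.single (bidegree m p) (1 : 𝕜) ⊗ₜ MvPolynomial.X p

/-- The coaction is counital. -/
lemma coaction_counit :
    (Algebra.TensorProduct.lid 𝕜 _).toAlgHom.comp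
      ((Algebra.TensorProduct.map (Bialgebra.counitAlgHom 𝕜 (TorusRing 𝕜)) (AlgHom.id 𝕜 _)).comp
        (coaction m 𝕜)) = AlgHom.id 𝕜 _ := by
  ext p; simp [coaction]

/-- The coaction is coassociative; with the previous fact, it defines an action of `𝔾ₘ²`. -/
lemma coaction_coassoc :
    (Algebra.TensorProduct.map (AlgHom.id 𝕜 (TorusRing 𝕜)) (coaction m 𝕜)).comp (coaction m 𝕜) =
      (Algebra.TensorProduct.assoc 𝕜 𝕜 𝕜 _ _ _).toAlgHom.comp
        ((Algebra.TensorProduct.map (Bialgebra.comulAlgHom 𝕜 (TorusRing 𝕜)) (AlgHom.id 𝕜 _)).comp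
          (coaction m 𝕜)) := by
  ext p; simp [coaction]

/-- The action morphism `𝔾ₘ² × B ⟶ B`. -/
def torusAction : pullback (torusStr 𝕜) (baseStr m 𝕜) ⟶ base m 𝕜 :=
  (pullbackSpecIso 𝕜 (TorusRing 𝕜) (ParamRing m 𝕜)).hom ≫
    Spec.map (CommRingCat.ofHom (coaction m 𝕜).toRingHom)

/-- An open subscheme `U` of `B` is `𝔾ₘ²`-stable if the action morphism maps the open subscheme
`𝔾ₘ² × U` of `𝔾ₘ² × B` into `U`. -/
def IsTorusStable (U : (base m 𝕜).Opens) : Prop :=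
  pullback.snd (torusStr 𝕜) (baseStr m 𝕜) ⁻¹ᵁ U ≤ torusAction m 𝕜 ⁻¹ᵁ U

end

end HilbertBurch

end

/-!
Write `T = 𝕜[𝐚][y]`. The entries with `-x` form the diagonal of the last `t` rows of `ℳ`, so the
minor removing the first row is up to sign a characteristic polynomial `χ`, monic of degree `t` in
`x`. The Hilbert–Burch relations express `x` times each of the other `t` minors as a `T`-combination
of all minors; hence `I_t(ℳ)` is the sum of `(χ)` and the `T`-span of those `t` minors, and
`T[x]/I_t(ℳ)` is the cokernel of an endomorphism of the free `T`-module `T[x]/(χ)` of rank `t`. The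
resultant lies in `I_t(ℳ) ∩ T`, so it kills this cokernel. Where one of its coefficients is
invertible it stays regular modulo every ideal of the base; then the endomorphism stays injective
modulo that ideal, because a surjection from a submodule of a finite module onto the module is
injective, and therefore the cokernel is flat over the base.

The entries of `ℳ` are bihomogeneous of bidegrees of the form `p_i + q_j`, so the minors are
bihomogeneous and the coaction multiplies each coefficient of the resultant by a unit.
-/

namespace HilbertBurch

section

variable {R M N P : Type*} [CommRing R] [AddCommGroup M] [AddCommGroup N] [AddCommGroup P]
  [Module R M] [Module R N] [Module R P]

lemma lift_lsmul_lTensor (I : Ideal R) (f : M →ₗ[R] N) :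
    TensorProduct.lift ((LinearMap.lsmul R N).comp I.subtype) ∘ₗ f.lTensor I =
      f ∘ₗ TensorProduct.lift ((LinearMap.lsmul R M).comp I.subtype) := by
  ext; simp

lemma range_lift_lsmul (I : Ideal R) :
    LinearMap.range (TensorProduct.lift ((LinearMap.lsmul R M).comp I.subtype)) =
      I • (⊤ : Submodule R M) := by
  refine le_antisymm ?_ (Submodule.smul_le.mpr fun a ha x _ ↦ ⟨⟨a, ha⟩ ⊗ₜ x, by simp⟩)
  rw [LinearMap.range_le_iff_comap, ← top_le_iff, ← TensorProduct.span_tmul_eq_top,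
    Submodule.span_le]
  rintro _ ⟨a, x, rfl⟩
  simpa using Submodule.smul_mem_smul a.2 (Submodule.mem_top (x := x))

theorem flat_of_exact_of_comap_le [Module.Flat R N] {f : M →ₗ[R] N} {g : N →ₗ[R] P}
    (hfg : Function.Exact f g) (hg : Function.Surjective g)
    (h : ∀ I : Ideal R, I.FG → (I • ⊤ : Submodule R N).comap f ≤ I • ⊤) : Module.Flat R P := by
  refine Module.Flat.iff_lift_lsmul_comp_subtype_injective.mpr fun I hI ↦
    (injective_iff_map_eq_zero _).mpr fun z hz ↦ ?_
  obtain ⟨w, rfl⟩ := LinearMap.lTensor_surjective I hg z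
  rw [← LinearMap.comp_apply, lift_lsmul_lTensor, LinearMap.comp_apply] at hz
  obtain ⟨x, hx⟩ := (hfg _).mp hz
  have hxI : x ∈ (I • ⊤ : Submodule R M) := h I hI (by
    rw [Submodule.mem_comap, hx, ← range_lift_lsmul]
    exact LinearMap.mem_range_self _ w)
  obtain ⟨w', rfl⟩ := (range_lift_lsmul I).ge hxI
  rw [← LinearMap.comp_apply, ← lift_lsmul_lTensor] at hx
  have hw := Module.Flat.iff_lift_lsmul_comp_subtype_injective.mp ‹Module.Flat R N› hI hx
  rw [← hw, ← LinearMap.comp_apply, ← LinearMap.lTensor_comp, hfg.linearMap_comp_eq_zero]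
  simp

end

section

variable {R M : Type*} [CommRing R] [AddCommGroup M] [Module R M]

lemma injective_of_smul_mem_range [Module.Finite R M] {f : Module.End R M} {s : R}
    (hs : IsSMulRegular M s) (hf : ∀ y, s • y ∈ LinearMap.range f) : Function.Injective f := by
  let e := LinearEquiv.ofInjective (LinearMap.lsmul R M s) hs
  let K := (LinearMap.range (LinearMap.lsmul R M s)).comap f
  let g : K →ₗ[R] M := e.symm ∘ₗ f.restrict (q := LinearMap.range (LinearMap.lsmul R M s))
    fun _ hx ↦ hx
  have hg : Function.Surjective g := fun y ↦ by
    obtain ⟨x, hx⟩ := hf y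
    exact ⟨⟨x, y, hx.symm⟩, e.symm_apply_eq.mpr (Subtype.ext hx)⟩
  have hg' := OrzechProperty.injective_of_surjective_of_injective K.subtype g K.injective_subtype hg
  refine (injective_iff_map_eq_zero f).mpr fun x hx ↦ ?_
  have hxK : x ∈ K := by simp [K, hx]
  refine congrArg Subtype.val (hg' (a₁ := ⟨x, hxK⟩) (a₂ := 0) ?_)
  rw [map_zero, LinearMap.comp_apply, LinearEquiv.coe_coe, e.symm_apply_eq, map_zero]
  exact Subtype.ext hx

end

section

variable {A T N P : Type*} [CommRing A] [CommRing T] [Algebra A T] [AddCommGroup N] [Module T N]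
  [Module A N] [IsScalarTower A T N] [AddCommGroup P] [Module T P] [Module A P]
  [IsScalarTower A T P]

theorem flat_of_exact_endomorphism [Module.Flat A T] [Module.Flat T N] [Module.Finite T N]
    {f : Module.End T N} {g : N →ₗ[T] P} (hfg : Function.Exact f g) (hg : Function.Surjective g)
    {s : T} (hsP : ∀ p : P, s • p = 0)
    (hs : ∀ I : Ideal A, IsSMulRegular (T ⧸ I.map (algebraMap A T)) s) : Module.Flat A P := by
  have : Module.Flat A N := Module.Flat.trans A T N
  refine flat_of_exact_of_comap_le (f := f.restrictScalars A) (g := g.restrictScalars A) hfg hg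
    fun I _ x hx ↦ ?_
  let J := I.map (algebraMap A T)
  have hJ : (J • ⊤ : Submodule T N).restrictScalars A = I • ⊤ := by
    simp [J, Ideal.smul_restrictScalars]
  have hsJ : IsSMulRegular (N ⧸ (J • ⊤ : Submodule T N)) s :=
    (TensorProduct.quotTensorEquivQuotSMul N J).isSMulRegular_congr s |>.mp ((hs I).rTensor _)
  have hinj := injective_of_smul_mem_range
    (f := Submodule.mapQ (J • ⊤) (J • ⊤) f (Submodule.smul_top_le_comap_smul_top J f)) hsJ (by
      intro y
      obtain ⟨y, rfl⟩ := Submodule.mkQ_surjective _ y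
      obtain ⟨x, hx⟩ := (hfg (s • y)).mp (by rw [map_smul, hsP])
      exact ⟨Submodule.Quotient.mk x, by simp [hx]⟩)
  rw [← hJ] at hx ⊢
  rw [Submodule.restrictScalars_mem, ← Submodule.Quotient.mk_eq_zero]
  refine hinj ?_
  rw [map_zero]
  simpa using hx

end

open scoped nonZeroDivisors in
lemma isSMulRegular_quotient_map_algebraMap {R : Type*} [CommRing R] {p : R[X]} {n : ℕ}
    (hp : IsUnit (p.coeff n)) (I : Ideal R) :
    IsSMulRegular (R[X] ⧸ I.map (algebraMap R R[X])) p := by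
  have hreg : p.map (Ideal.Quotient.mk I) ∈ (R ⧸ I)[X]⁰ :=
    Polynomial.mem_nonzeroDivisors_of_coeff_mem n <| by
      rw [Polynomial.coeff_map]
      exact (hp.map _).mem_nonZeroDivisors
  let e := I.polynomialQuotientEquivQuotientPolynomial
  have hmk : Ideal.Quotient.mk (I.map (algebraMap R R[X])) p ∈
      (R[X] ⧸ I.map (algebraMap R R[X]))⁰ := by
    have h := Submonoid.mem_map_of_mem e hreg
    rw [MulEquivClass.map_nonZeroDivisors] at h
    rwa [I.polynomialQuotientEquivQuotientPolynomial_map_mk] at h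
  have := (isRegular_iff_mem_nonZeroDivisors.mpr hmk).left
  exact (isSMulRegular_map (Ideal.Quotient.mk _) fun _ ↦ rfl).mp this.isSMulRegular

section

variable {R S : Type*} [CommRing R] [CommRing S] {t : ℕ}

/-- The maximal minor of a `(t + 1) × t` matrix with the `i`-th row removed; unlike in the
Hilbert–Burch relations, it carries no sign. -/
def rowMinor (M : Matrix (Fin (t + 1)) (Fin t) R) (i : Fin (t + 1)) : R :=
  (M.submatrix i.succAbove id).det

/-- The determinantal ideal of a `(t + 1) × t` matrix, generated by its maximal minors. -/
def detIdeal (M : Matrix (Fin (t + 1)) (Fin t) R) : Ideal R := Ideal.span (Set.range (rowMinor M))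

lemma rowMinor_mem_detIdeal (M : Matrix (Fin (t + 1)) (Fin t) R) (i : Fin (t + 1)) :
    rowMinor M i ∈ detIdeal M :=
  Ideal.subset_span (Set.mem_range_self i)

lemma sum_neg_one_pow_mul_rowMinor (M : Matrix (Fin (t + 1)) (Fin t) R) (j : Fin t) :
    ∑ i : Fin (t + 1), (-1) ^ (i : ℕ) * M i j * rowMinor M i = 0 := by
  have h : (Matrix.of fun i ↦ (Fin.cons (M i j) (M i) : Fin (t + 1) → R)).det = 0 :=
    Matrix.det_zero_of_column_eq (i := 0) (j := j.succ) (Fin.succ_ne_zero _).symm (by simp)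
  rw [Matrix.det_succ_column_zero] at h
  simpa [rowMinor, Matrix.submatrix] using h

lemma rowMinor_map (f : R →+* S) (M : Matrix (Fin (t + 1)) (Fin t) R) :
    rowMinor (M.map f) = f ∘ rowMinor M := by
  ext i
  simp [rowMinor, RingHom.map_det, Matrix.submatrix_map]

lemma map_detIdeal (f : R →+* S) (M : Matrix (Fin (t + 1)) (Fin t) R) :
    (detIdeal M).map f = detIdeal (M.map f) := by
  rw [detIdeal, Ideal.map_span, ← Set.range_comp, ← rowMinor_map, detIdeal]

lemma rowMinor_mul_row_mul_column (a : Fin (t + 1) → R) (b : Fin t → R)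
    (M : Matrix (Fin (t + 1)) (Fin t) R) (i : Fin (t + 1)) :
    rowMinor (Matrix.of fun i j ↦ a i * b j * M i j) i =
      (∏ k, a (i.succAbove k)) * (∏ j, b j) * rowMinor M i := by
  rw [rowMinor, rowMinor, mul_assoc, ← Matrix.det_mul_row, ← Matrix.det_mul_column]
  simp [Matrix.submatrix, mul_assoc]

/-- The matrix pencil `P - x J`, where `J` has the entries `1` just below the diagonal and `0`
elsewhere. The spread out matrix has this form, with its `x`-free part as `P`. -/
noncomputable def pencil (P : Matrix (Fin (t + 1)) (Fin t) R) : Matrix (Fin (t + 1)) (Fin t) R[X] :=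
  Matrix.of fun i j ↦ Polynomial.C (P i j) - if i = j.succ then Polynomial.X else 0

variable (P : Matrix (Fin (t + 1)) (Fin t) R)

lemma pencil_map (f : R →+* S) : (pencil P).map (Polynomial.mapRingHom f) = pencil (P.map f) := by
  ext1 i j
  simp [pencil, apply_ite (Polynomial.map f)]

lemma rowMinor_pencil_zero :
    rowMinor (pencil P) 0 = (-1) ^ t * (P.submatrix Fin.succ id).charpoly := by
  have h : (pencil P).submatrix (Fin.succAbove 0) id = -(P.submatrix Fin.succ id).charmatrix := by
    ext1 i j
    simp [pencil, Matrix.charmatrix, Matrix.diagonal_apply, Matrix.scalar_apply]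
  rw [rowMinor, h, Matrix.det_neg, Fintype.card_fin, Matrix.charpoly]

lemma X_mul_rowMinor_pencil_succ (j : Fin t) :
    Polynomial.X * rowMinor (pencil P) j.succ =
      ∑ i, ((-1) ^ (i.val + j.val + 1) * P i j) • rowMinor (pencil P) i := by
  have h := sum_neg_one_pow_mul_rowMinor (pencil P) j
  generalize rowMinor (pencil P) = f at h ⊢
  simp only [pencil, Matrix.of_apply, mul_sub, sub_mul, Finset.sum_sub_distrib, sub_eq_zero,
    mul_ite, ite_mul, mul_zero, zero_mul, Finset.sum_ite_eq', Finset.mem_univ, if_true] at h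
  have hsign : ((-1) ^ (j.val + 1) * (-1) ^ j.succ.val : R[X]) = 1 := by
    rw [Fin.val_succ, ← mul_pow, neg_one_mul, neg_neg, one_pow]
  calc Polynomial.X * f j.succ
      = (-1) ^ (j.val + 1) * ((-1) ^ j.succ.val * Polynomial.X * f j.succ) := by
        rw [mul_assoc, ← mul_assoc, hsign, one_mul]
    _ = ∑ i, ((-1) ^ (i.val + j.val + 1) * P i j) • f i := by
      rw [← h, Finset.mul_sum]
      refine Finset.sum_congr rfl fun i _ ↦ ?_
      simp only [Polynomial.smul_eq_C_mul, map_mul, map_pow, map_neg, map_one]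
      ring

lemma mul_mem_of_forall_X_mul_mem {W : Submodule R R[X]}
    (hW : ∀ q ∈ W, Polynomial.X * q ∈ W) (p : R[X]) : ∀ q ∈ W, p * q ∈ W := by
  induction p using Polynomial.induction_on with
  | C a => exact fun q hq ↦ Polynomial.smul_eq_C_mul (p := q) a ▸ W.smul_mem a hq
  | add p p' hp hp' => exact fun q hq ↦ add_mul p p' q ▸ add_mem (hp q hq) (hp' q hq)
  | monomial n a h =>
    intro q hq
    rw [pow_succ, ← mul_assoc, mul_assoc]
    exact h _ (hW q hq)

lemma charpoly_mem_detIdeal_pencil :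
    (P.submatrix Fin.succ id).charpoly ∈ detIdeal (pencil P) := by
  have h := Ideal.mul_mem_left _ ((-1) ^ t) (rowMinor_mem_detIdeal (pencil P) 0)
  rwa [rowMinor_pencil_zero, ← mul_assoc, ← mul_pow, neg_one_mul, neg_neg, one_pow, one_mul] at h

theorem detIdeal_pencil_restrictScalars :
    (detIdeal (pencil P)).restrictScalars R =
      (Ideal.span {(P.submatrix Fin.succ id).charpoly}).restrictScalars R ⊔
        Submodule.span R (Set.range fun j : Fin t ↦ rowMinor (pencil P) j.succ) := by
  set χ := (P.submatrix Fin.succ id).charpoly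
  set W := (Ideal.span {χ}).restrictScalars R ⊔
    Submodule.span R (Set.range fun j : Fin t ↦ rowMinor (pencil P) j.succ)
  have hminor : ∀ i, rowMinor (pencil P) i ∈ W := Fin.cases
    (Submodule.mem_sup_left <| by
      rw [rowMinor_pencil_zero]
      exact Ideal.mul_mem_left _ _ (Ideal.mem_span_singleton_self χ))
    fun j ↦ Submodule.mem_sup_right (Submodule.subset_span ⟨j, rfl⟩)
  have hX : W ≤ W.comap (LinearMap.mulLeft R Polynomial.X) := by
    refine sup_le (fun p hp ↦ Submodule.mem_sup_left (Ideal.mul_mem_left _ _ hp))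
      (Submodule.span_le.mpr ?_)
    rintro _ ⟨j, rfl⟩
    change Polynomial.X * rowMinor (pencil P) j.succ ∈ W
    rw [X_mul_rowMinor_pencil_succ]
    exact sum_mem fun i _ ↦ W.smul_mem _ (hminor i)
  refine le_antisymm (fun p hp ↦ ?_) (sup_le ?_ (Submodule.span_le.mpr ?_))
  · induction hp using Submodule.span_induction with
    | zero => exact W.zero_mem
    | add p q _ _ hp hq => exact W.add_mem hp hq
    | mem p hp => obtain ⟨i, rfl⟩ := hp; exact hminor i
    | smul p q _ hq => exact mul_mem_of_forall_X_mul_mem hX p q hq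
  · exact (Ideal.span_singleton_le_iff_mem _).mpr (charpoly_mem_detIdeal_pencil P)
  · rintro _ ⟨j, rfl⟩
    exact rowMinor_mem_detIdeal _ _

lemma C_resultant_mem {I : Ideal R[X]} {f g : R[X]} (hf : f ∈ I) (hg : g ∈ I)
    (hlead : IsUnit f.leadingCoeff) : Polynomial.C (f.resultant g) ∈ I := by
  rcases eq_or_ne f.natDegree 0 with h0 | h0
  · rw [Polynomial.leadingCoeff, h0] at hlead
    rw [Polynomial.eq_C_of_natDegree_eq_zero h0] at hf
    rw [Ideal.eq_top_of_isUnit_mem I hf (Polynomial.isUnit_C.mpr hlead)]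
    trivial
  · obtain ⟨p, q, -, -, h⟩ :=
      Polynomial.exists_mul_add_mul_eq_C_resultant f g le_rfl le_rfl (Or.inl h0)
    exact h ▸ add_mem (I.mul_mem_right _ hf) (I.mul_mem_right _ hg)

lemma isUnit_leadingCoeff_rowMinor_pencil_zero : IsUnit (rowMinor (pencil P) 0).leadingCoeff := by
  rw [rowMinor_pencil_zero, Polynomial.leadingCoeff_mul_monic (Matrix.charpoly_monic _),
    show ((-1) ^ t : R[X]) = Polynomial.C ((-1) ^ t) by simp, Polynomial.leadingCoeff_C]
  exact isUnit_one.neg.pow t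

lemma C_resultant_mem_detIdeal_pencil (i : Fin (t + 1)) :
    Polynomial.C ((rowMinor (pencil P) 0).resultant (rowMinor (pencil P) i)) ∈
      detIdeal (pencil P) :=
  C_resultant_mem (rowMinor_mem_detIdeal _ 0) (rowMinor_mem_detIdeal _ i)
    (isUnit_leadingCoeff_rowMinor_pencil_zero P)

end

theorem exists_exact_endomorphism {T : Type*} [CommRing T] {t : ℕ}
    (P : Matrix (Fin (t + 1)) (Fin t) T) :
    ∃ (f : Module.End T (AdjoinRoot (P.submatrix Fin.succ id).charpoly))
      (g : AdjoinRoot (P.submatrix Fin.succ id).charpoly →ₗ[T] T[X] ⧸ detIdeal (pencil P)),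
      Function.Exact f g ∧ Function.Surjective g := by
  rcases subsingleton_or_nontrivial T with _ | _
  · have := Module.subsingleton T (T[X] ⧸ detIdeal (pencil P))
    have := Module.subsingleton T (AdjoinRoot (P.submatrix Fin.succ id).charpoly)
    exact ⟨0, 0, fun x ↦ ⟨fun _ ↦ ⟨0, Subsingleton.elim _ _⟩, fun _ ↦ rfl⟩,
      fun p ↦ ⟨0, Subsingleton.elim _ _⟩⟩
  set χ := (P.submatrix Fin.succ id).charpoly with hχ
  have hdim : χ.natDegree = t := by simp [hχ, Matrix.charpoly_natDegree_eq_dim]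
  let b : Module.Basis (Fin t) T (AdjoinRoot χ) :=
    (AdjoinRoot.powerBasis' (Matrix.charpoly_monic _)).basis.reindex (finCongr hdim)
  let q : T[X] →ₗ[T] AdjoinRoot χ := (Ideal.Quotient.mkₐ T (Ideal.span {χ})).toLinearMap
  have hle : Ideal.span {χ} ≤ detIdeal (pencil P) :=
    (Ideal.span_singleton_le_iff_mem _).mpr (charpoly_mem_detIdeal_pencil P)
  let g : AdjoinRoot χ →ₗ[T] T[X] ⧸ detIdeal (pencil P) :=
    (Ideal.Quotient.factorₐ T hle).toLinearMap
  have hq : LinearMap.ker q = (Ideal.span {χ}).restrictScalars T :=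
    Submodule.ext fun _ ↦ Ideal.Quotient.eq_zero_iff_mem
  have hgq : (LinearMap.ker g).comap q = (detIdeal (pencil P)).restrictScalars T :=
    Submodule.ext fun _ ↦ Ideal.Quotient.eq_zero_iff_mem
  refine ⟨b.constr T fun j ↦ q (rowMinor (pencil P) j.succ), g, LinearMap.exact_iff.mpr ?_,
    Ideal.Quotient.factor_surjective hle⟩
  calc LinearMap.ker g = ((detIdeal (pencil P)).restrictScalars T).map q := by
        rw [← hgq, Submodule.map_comap_eq_of_surjective Ideal.Quotient.mk_surjective]
    _ = (Submodule.span T (Set.range fun j : Fin t ↦ rowMinor (pencil P) j.succ)).map q := by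
        rw [detIdeal_pencil_restrictScalars, Submodule.map_sup, ← hχ, ← hq,
          (LinearMap.le_ker_iff_map (f := q)).mp le_rfl, bot_sup_eq]
    _ = _ := by
        rw [Submodule.map_span, ← Set.range_comp, Module.Basis.constr_range]
        rfl

theorem flat_quotient_detIdeal_pencil {A : Type*} [CommRing A] {t : ℕ}
    {P : Matrix (Fin (t + 1)) (Fin t) A[X]} {s : A[X]} {n : ℕ}
    (hs : Polynomial.C s ∈ detIdeal (pencil P)) (hn : IsUnit (s.coeff n)) :
    Module.Flat A (A[X][X] ⧸ detIdeal (pencil P)) := by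
  obtain ⟨f, g, hfg, hg⟩ := exists_exact_endomorphism P
  have hmonic := Matrix.charpoly_monic (P.submatrix Fin.succ id)
  have := hmonic.free_adjoinRoot
  have := hmonic.finite_adjoinRoot
  refine flat_of_exact_endomorphism hfg hg (s := s) (fun p ↦ ?_)
    (isSMulRegular_quotient_map_algebraMap hn)
  obtain ⟨p, rfl⟩ := Ideal.Quotient.mk_surjective p
  rw [← Ideal.Quotient.mkₐ_eq_mk A[X], ← map_smul, Ideal.Quotient.mkₐ_eq_mk,
    Ideal.Quotient.eq_zero_iff_mem, Polynomial.smul_eq_C_mul]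
  exact Ideal.mul_mem_right _ _ hs

section

variable {R S : Type*} [CommRing R] [CommRing S]

lemma sylvester_comp_C_mul_X (f g : R[X]) (m n : ℕ) (r : R) :
    (f.comp (Polynomial.C r * Polynomial.X)).sylvester
        (g.comp (Polynomial.C r * Polynomial.X)) m n *
        Matrix.diagonal (Fin.addCases (fun j : Fin m ↦ r ^ (j : ℕ)) fun j : Fin n ↦ r ^ (j : ℕ)) =
      Matrix.diagonal (fun i : Fin (m + n) ↦ r ^ (i : ℕ)) * f.sylvester g m n := by
  ext i j
  rw [Matrix.mul_diagonal, Matrix.diagonal_mul]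
  induction j using Fin.addCases <;>
  · simp only [Polynomial.sylvester, Matrix.of_apply, Fin.addCases_left, Fin.addCases_right,
      Polynomial.comp_C_mul_X_coeff, ite_mul, mul_ite, zero_mul, mul_zero]
    refine if_ctx_congr Iff.rfl (fun h ↦ ?_) fun _ ↦ rfl
    rw [mul_assoc, ← pow_add, Nat.sub_add_cancel h.1, mul_comm]

lemma resultant_comp_C_mul_X (f g : R[X]) (m n : ℕ) {r : R} (hr : IsRegular r) :
    (f.comp (Polynomial.C r * Polynomial.X)).resultant
      (g.comp (Polynomial.C r * Polynomial.X)) m n = r ^ (m * n) * f.resultant g m n := by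
  have hdet := congrArg Matrix.det (sylvester_comp_C_mul_X f g m n r)
  simp only [Matrix.det_mul, Matrix.det_diagonal, Finset.prod_pow_eq_pow_sum, Fin.prod_univ_add,
    Fin.addCases_left, Fin.addCases_right, Fin.val_castAdd, Fin.val_natAdd, ← pow_add,
    Finset.sum_add_distrib, Finset.sum_const, Finset.card_univ, Fintype.card_fin, smul_eq_mul,
    Fin.sum_univ_add, mul_comm n m] at hdet
  refine (hr.pow (∑ j : Fin m, (j : ℕ) + ∑ j : Fin n, (j : ℕ))).right (hdet.trans ?_)
  rw [add_left_comm, pow_add, mul_right_comm, Polynomial.resultant]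

/-- The substitution `x ↦ r x` in a polynomial in `x`, as a ring homomorphism. -/
noncomputable def scaleVar (r : R) : R[X] →+* R[X] :=
  Polynomial.compRingHom (Polynomial.C r * Polynomial.X)

lemma scaleVar_C (r a : R) : scaleVar r (Polynomial.C a) = Polynomial.C a := by simp [scaleVar]

lemma scaleVar_X (r : R) : scaleVar r Polynomial.X = Polynomial.C r * Polynomial.X := by
  simp [scaleVar]

lemma coeff_scaleVar (r : R) (f : R[X]) (n : ℕ) : (scaleVar r f).coeff n = f.coeff n * r ^ n :=
  Polynomial.comp_C_mul_X_coeff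

/-- The action of a point `(u, v)` of the torus on polynomials in two variables, covering a map `γ`
of coefficient rings: the outer variable `x` goes to `u x` and the inner variable `y` to `v y`. -/
noncomputable def scaleVars (γ : S →+* R) (u v : R) : S[X][X] →+* R[X][X] :=
  (scaleVar (Polynomial.C u)).comp
    (Polynomial.mapRingHom ((scaleVar v).comp (Polynomial.mapRingHom γ)))

lemma scaleVars_C (γ : S →+* R) (u v : R) (p : S[X]) :
    scaleVars γ u v (Polynomial.C p) = Polynomial.C (scaleVar v (p.map γ)) := by
  simp [scaleVars, scaleVar_C]

lemma scaleVars_X (γ : S →+* R) (u v : R) :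
    scaleVars γ u v Polynomial.X = Polynomial.C (Polynomial.C u) * Polynomial.X := by
  simp [scaleVars, scaleVar_X]

lemma resultant_of_scaleVars_eq {ι γ : S →+* R} {u v e₁ e₂ : R} (hu : IsUnit u) {f g : S[X][X]}
    (hf : scaleVars γ u v f =
      Polynomial.C (Polynomial.C e₁) * f.map (Polynomial.mapRingHom ι))
    (hg : scaleVars γ u v g =
      Polynomial.C (Polynomial.C e₂) * g.map (Polynomial.mapRingHom ι)) :
    Polynomial.C (u ^ (f.natDegree * g.natDegree)) * scaleVar v ((f.resultant g).map γ) =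
      Polynomial.C (e₁ ^ g.natDegree * e₂ ^ f.natDegree) * (f.resultant g).map ι := by
  have h := resultant_comp_C_mul_X (f.map ((scaleVar v).comp (Polynomial.mapRingHom γ)))
    (g.map ((scaleVar v).comp (Polynomial.mapRingHom γ))) f.natDegree g.natDegree
    (hu.map (Polynomial.C (R := R))).isRegular
  change (scaleVars γ u v f).resultant (scaleVars γ u v g) _ _ = _ at h
  rw [hf, hg, Polynomial.resultant_C_mul_left, Polynomial.resultant_C_mul_right,
    Polynomial.resultant_map_map, Polynomial.resultant_map_map] at h
  simp only [map_mul, map_pow, mul_assoc]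
  exact h.symm

lemma associated_coeff_resultant_of_scaleVars_eq {ι γ : S →+* R} {u v e₁ e₂ : R} (hu : IsUnit u)
    (hv : IsUnit v) (he₁ : IsUnit e₁) (he₂ : IsUnit e₂) {f g : S[X][X]}
    (hf : scaleVars γ u v f =
      Polynomial.C (Polynomial.C e₁) * f.map (Polynomial.mapRingHom ι))
    (hg : scaleVars γ u v g =
      Polynomial.C (Polynomial.C e₂) * g.map (Polynomial.mapRingHom ι)) (n : ℕ) :
    Associated (γ ((f.resultant g).coeff n)) (ι ((f.resultant g).coeff n)) := by
  have h := congrArg (Polynomial.coeff · n) (resultant_of_scaleVars_eq hu hf hg)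
  simp only [Polynomial.coeff_C_mul, Polynomial.coeff_map, coeff_scaleVar] at h
  have hl : IsUnit (u ^ (f.natDegree * g.natDegree) * v ^ n) := (hu.pow _).mul (hv.pow n)
  have hr : IsUnit (e₁ ^ g.natDegree * e₂ ^ f.natDegree) := (he₁.pow _).mul (he₂.pow _)
  rw [mul_comm (γ _), ← mul_assoc] at h
  exact (associated_unit_mul_left _ _ hl).symm.trans (h ▸ associated_unit_mul_left _ _ hr)

end

section

variable {t : ℕ} (m : Fin (t + 1) → ℕ) (𝕜 : Type u) [Field 𝕜]

/-- The specialization of `ℳ` at `x = 0`, so that `ℳ` is the pencil of this matrix. -/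
noncomputable def constMatrix : Matrix (Fin (t + 1)) (Fin t) (ParamRing m 𝕜)[X] :=
  Matrix.of fun i j ↦ (if i = j.castSucc then Polynomial.X ^ diff m j else 0) + paramEntry m 𝕜 i j

lemma spreadMatrix_eq_pencil : spreadMatrix m 𝕜 = pencil (constMatrix m 𝕜) := by
  ext1 i j
  simp only [spreadMatrix, pencil, constMatrix, Matrix.of_apply, map_add, apply_ite Polynomial.C,
    map_zero]
  ring

lemma maxMinor_eq_rowMinor (i : Fin (t + 1)) :
    maxMinor m 𝕜 i = rowMinor (spreadMatrix m 𝕜) i :=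
  rfl

lemma minorIdeal_eq_detIdeal : minorIdeal m 𝕜 = detIdeal (pencil (constMatrix m 𝕜)) := by
  rw [← spreadMatrix_eq_pencil]
  rfl

lemma C_resE_mem_minorIdeal : Polynomial.C (resE m 𝕜) ∈ minorIdeal m 𝕜 := by
  have h := C_resultant_mem_detIdeal_pencil (constMatrix m 𝕜) (Fin.last t)
  rw [← spreadMatrix_eq_pencil] at h
  exact h

end

section

variable {t : ℕ} {m : Fin (t + 1) → ℕ} {𝕜 : Type u} [Field 𝕜] {R : Type*} [CommRing R]
  {ι γ : ParamRing m 𝕜 →+* R} {w : Multiplicative (ℤ × ℤ) →* R}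

variable (m) in
/-- The bidegree in which the `(i,j)` entry of `ℳ` is homogeneous; indices count from `0`, which
turns `m_j - m_(i-1)` into `m (j + 1) - m i`. -/
def entryDegree (i : Fin (t + 1)) (j : Fin t) : ℤ × ℤ := ((i : ℤ) - j, (m j.succ : ℤ) - m i)

lemma character_eq_mul_pow (a : ℤ × ℤ) (n : ℕ) :
    w (.ofAdd a) = w (.ofAdd (a - (0, (n : ℤ)))) * w (.ofAdd (0, 1)) ^ n := by
  rw [← map_pow, ← map_mul, ← ofAdd_nsmul, ← ofAdd_add]
  simp

lemma scaleVar_paramEntry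
    (hγ : ∀ p, γ (MvPolynomial.X p) = w (.ofAdd (bidegree m p)) * ι (MvPolynomial.X p))
    (i : Fin (t + 1)) (j : Fin t) :
    scaleVar (w (.ofAdd (0, 1))) ((paramEntry m 𝕜 i j).map γ) =
      Polynomial.C (w (.ofAdd (entryDegree m i j))) * (paramEntry m 𝕜 i j).map ι := by
  simp only [paramEntry, Polynomial.map_sum, Polynomial.map_mul, Polynomial.map_C,
    Polynomial.map_pow, Polynomial.map_X, map_sum, map_mul, map_pow, scaleVar_C, scaleVar_X,
    Finset.mul_sum]
  refine Finset.sum_congr rfl fun k _ ↦ ?_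
  have hdeg : bidegree m ⟨(i, j), k⟩ = entryDegree m i j - (0, (k : ℤ)) := by
    simp [bidegree, entryDegree]
  rw [hγ, hdeg, character_eq_mul_pow (entryDegree m i j) k, map_mul, map_mul, map_pow]
  ring

lemma scaleVars_spreadMatrix (hm : Monotone m)
    (hγ : ∀ p, γ (MvPolynomial.X p) = w (.ofAdd (bidegree m p)) * ι (MvPolynomial.X p))
    (i : Fin (t + 1)) (j : Fin t) :
    scaleVars γ (w (.ofAdd (1, 0))) (w (.ofAdd (0, 1))) (spreadMatrix m 𝕜 i j) =
      Polynomial.C (Polynomial.C (w (.ofAdd (entryDegree m i j)))) *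
        (spreadMatrix m 𝕜 i j).map (Polynomial.mapRingHom ι) := by
  have hdiag (h : i = j.castSucc) :
      w (.ofAdd (0, 1)) ^ diff m j = w (.ofAdd (entryDegree m i j)) := by
    rw [character_eq_mul_pow (entryDegree m i j) (diff m j)]
    have : entryDegree m i j - (0, (diff m j : ℤ)) = 0 := by
      simp [entryDegree, diff, h, Nat.cast_sub (hm j.castSucc_le_succ)]
    simp [this]
  have hsub (h : i = j.succ) : entryDegree m i j = (1, 0) := by simp [entryDegree, h]
  simp only [spreadMatrix_eq_pencil, pencil, constMatrix, Matrix.of_apply, map_sub, scaleVars_C,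
    Polynomial.map_add, map_add, scaleVar_paramEntry hγ, Polynomial.map_sub, Polynomial.map_C,
    mul_sub, mul_add]
  congr 1
  · split_ifs with h
    · simp [mul_pow, scaleVar_X, ← hdiag h]
    · simp
  · split_ifs with h
    · simp [scaleVars_X, hsub h]
    · simp

lemma exists_scaleVars_maxMinor (hm : Monotone m)
    (hγ : ∀ p, γ (MvPolynomial.X p) = w (.ofAdd (bidegree m p)) * ι (MvPolynomial.X p))
    (i : Fin (t + 1)) : ∃ e : R, IsUnit e ∧
      scaleVars γ (w (.ofAdd (1, 0))) (w (.ofAdd (0, 1))) (maxMinor m 𝕜 i) =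
        Polynomial.C (Polynomial.C e) * (maxMinor m 𝕜 i).map (Polynomial.mapRingHom ι) := by
  let α (i : Fin (t + 1)) : R := w (.ofAdd ((i : ℤ), -(m i : ℤ)))
  let β (j : Fin t) : R := w (.ofAdd (-(j : ℤ), (m j.succ : ℤ)))
  have hαβ i j : w (.ofAdd (entryDegree m i j)) = α i * β j := by
    rw [← map_mul, ← ofAdd_add]
    simp [entryDegree, sub_eq_add_neg, add_comm]
  have hw a : IsUnit (w a) := (Group.isUnit a).map w
  refine ⟨(∏ k, α (i.succAbove k)) * ∏ j, β j,
    (IsUnit.prod_univ_iff.mpr fun _ ↦ hw _).mul (IsUnit.prod_univ_iff.mpr fun _ ↦ hw _), ?_⟩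
  have hentry := rowMinor_mul_row_mul_column (fun i ↦ Polynomial.C (Polynomial.C (α i)))
    (fun j ↦ Polynomial.C (Polynomial.C (β j)))
    ((spreadMatrix m 𝕜).map (Polynomial.mapRingHom (Polynomial.mapRingHom ι))) i
  have hscale : (spreadMatrix m 𝕜).map (scaleVars γ (w (.ofAdd (1, 0))) (w (.ofAdd (0, 1)))) =
      Matrix.of fun i j ↦ Polynomial.C (Polynomial.C (α i)) * Polynomial.C (Polynomial.C (β j)) *
        (spreadMatrix m 𝕜).map (Polynomial.mapRingHom (Polynomial.mapRingHom ι)) i j := by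
    ext1 i j
    simp [scaleVars_spreadMatrix hm hγ, hαβ]
  rw [← hscale, rowMinor_map, rowMinor_map] at hentry
  simpa [maxMinor_eq_rowMinor] using hentry

end

section

variable {t : ℕ} (m : Fin (t + 1) → ℕ) (𝕜 : Type u) [Field 𝕜]

lemma associated_coaction_coeff_resE (hm : Monotone m) (n : ℕ) :
    Associated (coaction m 𝕜 ((resE m 𝕜).coeff n))
      (1 ⊗ₜ (resE m 𝕜).coeff n : TorusRing 𝕜 ⊗[𝕜] ParamRing m 𝕜) := by
  let ι : ParamRing m 𝕜 →ₐ[𝕜] TorusRing 𝕜 ⊗[𝕜] ParamRing m 𝕜 := Algebra.TensorProduct.includeRight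
  let w : Multiplicative (ℤ × ℤ) →* TorusRing 𝕜 ⊗[𝕜] ParamRing m 𝕜 :=
    (Algebra.TensorProduct.includeLeft : TorusRing 𝕜 →ₐ[𝕜] _).toMonoidHom.comp
      (AddMonoidAlgebra.of 𝕜 (ℤ × ℤ))
  have hγ p : (coaction m 𝕜 : ParamRing m 𝕜 →+* _) (MvPolynomial.X p) =
      w (.ofAdd (bidegree m p)) * (ι : ParamRing m 𝕜 →+* _) (MvPolynomial.X p) := by
    simp [coaction, ι, w]
  have hw a : IsUnit (w a) := (Group.isUnit a).map w
  obtain ⟨e₁, he₁, h₁⟩ := exists_scaleVars_maxMinor hm hγ 0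
  obtain ⟨e₂, he₂, h₂⟩ := exists_scaleVars_maxMinor hm hγ (Fin.last t)
  exact associated_coeff_resultant_of_scaleVars_eq (hw _) (hw _) he₁ he₂ h₁ h₂ n

end

lemma flat_tensorProduct_quotient {R A : Type*} [CommRing R] [CommRing A] [Algebra R A]
    {I : Ideal R[X][X]}
    (h : Module.Flat A (A[X][X] ⧸
      I.map (Polynomial.mapRingHom (Polynomial.mapRingHom (algebraMap R A))))) :
    Module.Flat A (A ⊗[R] (R[X][X] ⧸ I)) := by
  let := Polynomial.algebra R A
  let := Polynomial.algebra R[X] A[X]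
  have : Module.Flat A (A[X][X] ⧸ I.map (algebraMap R[X][X] A[X][X])) := h
  let e₁ := Algebra.IsPushout.cancelBaseChange R A R[X] A[X] (R[X][X] ⧸ I)
  let e₂ := Algebra.IsPushout.cancelBaseChange R[X] A[X] R[X][X] A[X][X] (R[X][X] ⧸ I)
  let e₃ := Algebra.TensorProduct.quotIdealMapEquivTensorQuot A[X][X] I
  exact .of_linearEquiv <| e₁.symm ≪≫ₗ e₂.symm.restrictScalars A ≪≫ₗ
    e₃.symm.toLinearEquiv.restrictScalars A

theorem flat_tensorProduct_quotient_detIdeal_pencil {R A : Type*} [CommRing R] [CommRing A]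
    [Algebra R A] {t : ℕ} {P : Matrix (Fin (t + 1)) (Fin t) R[X]} {s : R[X]} {n : ℕ}
    (hs : Polynomial.C s ∈ detIdeal (pencil P)) (hn : IsUnit (algebraMap R A (s.coeff n))) :
    Module.Flat A (A ⊗[R] (R[X][X] ⧸ detIdeal (pencil P))) := by
  let ψ := algebraMap R A
  have hs' := Ideal.mem_map_of_mem (Polynomial.mapRingHom (Polynomial.mapRingHom ψ)) hs
  rw [map_detIdeal, pencil_map, Polynomial.coe_mapRingHom (Polynomial.mapRingHom ψ),
    Polynomial.map_C] at hs'
  refine flat_tensorProduct_quotient ?_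
  rw [map_detIdeal, pencil_map]
  exact flat_quotient_detIdeal_pencil hs' (n := n) (by simpa using hn)

lemma flat_pullback_snd_SpecMap {R S A : Type u} [CommRing R] [CommRing S] [CommRing A]
    [Algebra R S] [Algebra R A] (h : Module.Flat A (A ⊗[R] S)) :
    Flat (pullback.snd (Spec.map (CommRingCat.ofHom (algebraMap R S)))
      (Spec.map (CommRingCat.ofHom (algebraMap R A)))) := by
  have : Flat (Spec.map (CommRingCat.ofHom (algebraMap A (A ⊗[R] S)))) :=
    Flat.SpecMap_iff.mpr (RingHom.flat_algebraMap_iff.mpr h)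
  rw [← pullbackSymmetry_hom_comp_fst, ← pullbackSpecIso_hom_fst']
  infer_instance

lemma restrict_iSup_opensRange {P : MorphismProperty Scheme.{u}} [IsZariskiLocalAtTarget P]
    {X Y : Scheme.{u}} (f : X ⟶ Y) {ι : Type*} {W : ι → Scheme.{u}} (j : ∀ i, W i ⟶ Y)
    [∀ i, IsOpenImmersion (j i)] (h : ∀ i, P (pullback.snd f (j i))) :
    P (f ∣_ ⨆ i, (j i).opensRange) := by
  set U := ⨆ i, (j i).opensRange
  refine IsZariskiLocalAtTarget.of_iSup_eq_top (fun i ↦ U.ι ⁻¹ᵁ (j i).opensRange) ?_ fun i ↦ ?_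
  · rw [← Scheme.Hom.preimage_iSup, Scheme.Opens.ι_preimage_self]
  · have hle : (j i).opensRange ≤ U := le_iSup (fun i ↦ (j i).opensRange) i
    have hrange : U.ι ''ᵁ U.ι ⁻¹ᵁ (j i).opensRange = (j i).opensRange := by
      simpa [Scheme.Hom.image_preimage_eq_opensRange_inf] using hle
    exact (P.arrow_mk_iso_iff (morphismRestrictRestrict _ _ _ ≪≫ morphismRestrictEq f hrange ≪≫
      morphismRestrictOpensRange f (j i))).mpr (h i)

lemma flat_restrict_iSup_basicOpen {R S : Type u} [CommRing R] [CommRing S] [Algebra R S]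
    {ι : Type*} (c : ι → R)
    (h : ∀ i, Module.Flat (Localization.Away (c i)) (Localization.Away (c i) ⊗[R] S)) :
    Flat (Spec.map (CommRingCat.ofHom (algebraMap R S)) ∣_
      ⨆ i, (PrimeSpectrum.basicOpen (c i) : (Spec (CommRingCat.of R)).Opens)) := by
  let j (i : ι) := Spec.map (CommRingCat.ofHom (algebraMap R (Localization.Away (c i))))
  have (i : ι) : IsOpenImmersion (j i) :=
    inferInstanceAs (IsOpenImmersion (Spec.map (CommRingCat.ofHom (algebraMap _ _))))
  have hU : (⨆ i, PrimeSpectrum.basicOpen (c i) : (Spec (CommRingCat.of R)).Opens) =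
      ⨆ i, (j i).opensRange := iSup_congr fun i ↦
    TopologicalSpace.Opens.ext (PrimeSpectrum.localization_away_comap_range _ (c i)).symm
  have := HasRingHomProperty.instIsZariskiLocalAtTarget @Flat.{u}
  rw [hU]
  exact restrict_iSup_opensRange (P := @Flat) _ j fun i ↦ flat_pullback_snd_SpecMap (h i)

section

variable {t : ℕ} (m : Fin (t + 1) → ℕ) (𝕜 : Type u) [Field 𝕜]

lemma familyMap_eq : familyMap m 𝕜 = Spec.map (CommRingCat.ofHom
    (algebraMap (ParamRing m 𝕜) ((ParamRing m 𝕜)[X][X] ⧸ minorIdeal m 𝕜))) := by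
  rw [familyMap, vanishingIncl, planeProj, ← Spec.map_comp]
  rfl

lemma isOpen_resLocus : IsOpen (resLocus m 𝕜) :=
  (PrimeSpectrum.isClosed_zeroLocus _).isOpen_compl

lemma mem_resLocus (x : base m 𝕜) :
    x ∈ resLocus m 𝕜 ↔ ∃ n, (resE m 𝕜).coeff n ∉ x.asIdeal :=
  (not_congr Set.range_subset_iff).trans not_forall

lemma resLocus_eq_iSup_basicOpen : (⟨resLocus m 𝕜, isOpen_resLocus m 𝕜⟩ : (base m 𝕜).Opens) =
    ⨆ n, PrimeSpectrum.basicOpen ((resE m 𝕜).coeff n) := by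
  ext x
  exact (mem_resLocus m 𝕜 x).trans (TopologicalSpace.Opens.mem_iSup
    (s := fun n ↦ PrimeSpectrum.basicOpen ((resE m 𝕜).coeff n))).symm

theorem flat_familyMap_restrict_resLocus :
    Flat (familyMap m 𝕜 ∣_ ⟨resLocus m 𝕜, isOpen_resLocus m 𝕜⟩) := by
  rw [resLocus_eq_iSup_basicOpen, familyMap_eq]
  refine flat_restrict_iSup_basicOpen _ fun n ↦ ?_
  rw [minorIdeal_eq_detIdeal]
  refine flat_tensorProduct_quotient_detIdeal_pencil (s := resE m 𝕜) (n := n) ?_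
    (IsLocalization.Away.algebraMap_isUnit _)
  rw [← minorIdeal_eq_detIdeal]
  exact C_resE_mem_minorIdeal m 𝕜

theorem isTorusStable_resLocus (hm : Monotone m) :
    IsTorusStable m 𝕜 ⟨resLocus m 𝕜, isOpen_resLocus m 𝕜⟩ := by
  intro z hz
  obtain ⟨z, rfl⟩ := (pullbackSpecIso 𝕜 (TorusRing 𝕜) (ParamRing m 𝕜)).inv.surjective z
  have hz : pullback.snd (torusStr 𝕜) (baseStr m 𝕜)
      ((pullbackSpecIso 𝕜 (TorusRing 𝕜) (ParamRing m 𝕜)).inv z) ∈ resLocus m 𝕜 := hz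
  change torusAction m 𝕜 ((pullbackSpecIso 𝕜 (TorusRing 𝕜) (ParamRing m 𝕜)).inv z) ∈
    resLocus m 𝕜
  rw [← Scheme.Hom.comp_apply] at hz ⊢
  rw [torusAction, Iso.inv_hom_id_assoc]
  rw [pullbackSpecIso_inv_snd] at hz
  obtain ⟨n, hn⟩ := (mem_resLocus m 𝕜 _).mp hz
  exact (mem_resLocus m 𝕜 _).mpr ⟨n, fun h ↦ hn <|
    z.asIdeal.mem_of_dvd (associated_coaction_coeff_resE m 𝕜 hm n).dvd h⟩

end

end HilbertBurch

/-- For a monomial ideal `E` of finite positive colength, the locus `B'` is open, it is stable under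
the torus, and `π` is flat over it. -/
theorem lemma6p2 {𝕜 : Type u} [Field 𝕜] (d : ℕ) (hd : 0 < d)
    (E : Ideal (Polynomial (Polynomial 𝕜)))
    (hE : Module.finrank 𝕜 (Polynomial (Polynomial 𝕜) ⧸ E) = d)
    (t : ℕ) (m : Fin (t + 1) → ℕ) (hm : HilbertBurch.IsStaircase E t m) :
    ∃ hopen : IsOpen (HilbertBurch.resLocus m 𝕜),
      HilbertBurch.IsTorusStable m 𝕜 ⟨HilbertBurch.resLocus m 𝕜, hopen⟩ ∧
      Flat (HilbertBurch.familyMap m 𝕜 ∣_ ⟨HilbertBurch.resLocus m 𝕜, hopen⟩) :=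
  ⟨HilbertBurch.isOpen_resLocus m 𝕜, HilbertBurch.isTorusStable_resLocus m 𝕜 hm.mono,
    HilbertBurch.flat_familyMap_restrict_resLocus m 𝕜⟩
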